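/- Work in ZFC. Let $\lambda$ be an infinite cardinal with $2^{<\lambda} \le \lambda^+$, where $2^{<\lambda} = \sup_{\mu<\lambda} 2^\mu$ over cardinals $\mu$ (for instance, any strong limit cardinal $\lambda$). Let $H(\lambda^+)$ be the set of all sets whose transitive closure has fewer than $\lambda^+$ elements, and let $\mathscr{E}$ be the monoid, under composition, of all $\Delta_0$-embeddings $j : H(\lambda^+) \to H(\lambda^+)$, that is, of all maps which preserve and reflect every $\Delta_0$ formula of the language of set theory. Let $P_{\lambda^{++}}(H(\lambda^+))$ be the set of all subsets of $H(\lambda^+)$ with fewer than $\lambda^{++}$ elements, with the discrete topology, and let $\mathscr{E}$ act on it by \[ j^+(A) = \bigcup_{x \in H(\lambda^+)} j(A \cap x). \] Then, for every topology $\tau$ on $\mathscr{E}$, the action map $\mathscr{E} \times P_{\lambda^{++}}(H(\lambda^+)) \to P_{\lambda^{++}}(H(\lambda^+))$, $(j, A) \mapsto j^+(A)$, is continuous for the product topology if and only if $\tau$ is the discrete topology. -/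

import Mathlib

open Cardinal Order

universe u

namespace DeltaZeroAction

/-! ### Transitive closures and the sets `H(κ)` -/

/-- The transitive closure of `x`: the union of `x`, `⋃ x`, `⋃ ⋃ x`, and so on. -/
noncomputable def trcl (x : ZFSet.{u}) : ZFSet.{u} :=
  ZFSet.iUnion (fun n : ℕ => ZFSet.sUnion^[n] x)

theorem mem_trcl {x y : ZFSet.{u}} : y ∈ trcl x ↔ ∃ n : ℕ, y ∈ ZFSet.sUnion^[n] x :=
  ZFSet.mem_iUnion

theorem subset_trcl (x : ZFSet.{u}) : x ⊆ trcl x := fun _ hy => mem_trcl.2 ⟨0, hy⟩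

theorem isTransitive_trcl (x : ZFSet.{u}) : (trcl x).IsTransitive := by
  intro y hy z hz
  obtain ⟨n, hn⟩ := mem_trcl.1 hy
  refine mem_trcl.2 ⟨n + 1, ?_⟩
  rw [Function.iterate_succ_apply']
  exact ZFSet.mem_sUnion_of_mem hz hn

theorem trcl_subset {x t : ZFSet.{u}} (ht : t.IsTransitive) (hx : x ⊆ t) : trcl x ⊆ t := by
  intro y hy
  obtain ⟨n, hn⟩ := mem_trcl.1 hy
  clear hy
  induction n generalizing y with
  | zero => exact hx hn
  | succ n ih =>
    rw [Function.iterate_succ_apply'] at hn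
    obtain ⟨z, hz, hyz⟩ := ZFSet.mem_sUnion.1 hn
    exact ht z (ih hz) hyz

/-- `H(κ)`: the sets whose transitive closure has fewer than `κ` elements. -/
def H (κ : Cardinal.{u}) : Set ZFSet.{u} := {x | (trcl x).card < κ}

theorem mem_H_of_subset {κ : Cardinal.{u}} {x t : ZFSet.{u}} (ht : t.IsTransitive) (hx : x ⊆ t)
    (hc : t.card < κ) : x ∈ H κ :=
  (ZFSet.card_mono (trcl_subset ht hx)).trans_lt hc

theorem H_of_subset {κ : Cardinal.{u}} {x y : ZFSet.{u}} (hx : x ∈ H κ) (hy : y ⊆ x) : y ∈ H κ :=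
  mem_H_of_subset (isTransitive_trcl x) (fun _ hz => subset_trcl x (hy hz)) hx

theorem H_of_mem {κ : Cardinal.{u}} {x y : ZFSet.{u}} (hx : x ∈ H κ) (hy : y ∈ x) : y ∈ H κ :=
  mem_H_of_subset (isTransitive_trcl x) (isTransitive_trcl x y (subset_trcl x hy)) hx

theorem card_lt_of_mem_H {κ : Cardinal.{u}} {x : ZFSet.{u}} (hx : x ∈ H κ) : x.card < κ :=
  (ZFSet.card_mono (subset_trcl x)).trans_lt hx

/-- A subset of `H(λ⁺)` with at most `λ` elements is an element of `H(λ⁺)`. -/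
theorem mem_H_of_card_le {lam : Cardinal.{u}} (hl : ℵ₀ ≤ lam) {a : ZFSet.{u}}
    (ha : ∀ x ∈ a, x ∈ H (succ lam)) (hc : a.card ≤ lam) : a ∈ H (succ lam) := by
  let f : Shrink.{u} a → ZFSet.{u} := fun i => trcl ((equivShrink a).symm i).1
  have ht : (a ∪ ZFSet.iUnion f).IsTransitive := by
    intro y hy z hz
    rw [ZFSet.mem_union] at hy ⊢
    right
    rw [ZFSet.mem_iUnion] at hy ⊢
    rcases hy with hy | ⟨i, hi⟩
    · exact ⟨equivShrink a ⟨y, hy⟩, by simpa [f] using subset_trcl y hz⟩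
    · exact ⟨i, isTransitive_trcl _ y hi hz⟩
  refine mem_H_of_subset ht (fun _ h => ZFSet.mem_union.2 (Or.inl h)) (lt_succ_of_le ?_)
  have h1 : (ZFSet.iUnion f).card ≤ lam := by
    have h := ZFSet.lift_card_iUnion_le_sum_card (f := f)
    rw [Cardinal.lift_id] at h
    refine h.trans ((Cardinal.sum_le_mk_mul_iSup _).trans ?_)
    refine (mul_le_mul' hc (ciSup_le' fun i => ?_)).trans (Cardinal.mul_eq_self hl).le
    exact le_of_lt_succ (ha _ ((equivShrink a).symm i).2)
  exact ZFSet.card_union_le.trans ((add_le_add hc h1).trans (Cardinal.add_eq_self hl).le)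

/-! ### `Δ₀` formulas and embeddings -/

/-- `Δ₀` formulas of the language of set theory in `n` free variables: every quantifier is
bounded. The other connectives and `∃ z ∈ v i` are the usual abbreviations. -/
inductive DeltaZeroFormula : ℕ → Type
  | eq {n : ℕ} (i k : Fin n) : DeltaZeroFormula n
  | mem {n : ℕ} (i k : Fin n) : DeltaZeroFormula n
  | neg {n : ℕ} (φ : DeltaZeroFormula n) : DeltaZeroFormula n
  | and {n : ℕ} (φ ψ : DeltaZeroFormula n) : DeltaZeroFormula n
  /-- `∀ z ∈ v i, φ(z, v)`: in `φ` the variable `0` is `z`, and `k + 1` is the old `k`. -/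
  | ball {n : ℕ} (i : Fin n) (φ : DeltaZeroFormula (n + 1)) : DeltaZeroFormula n

/-- Satisfaction of a `Δ₀` formula in the structure `(M, ∈)`. -/
def DeltaZeroFormula.Sat {M : Set ZFSet.{u}} : {n : ℕ} → DeltaZeroFormula n → (Fin n → M) → Prop
  | _, .eq i k, v => v i = v k
  | _, .mem i k, v => (v i : ZFSet.{u}) ∈ (v k : ZFSet.{u})
  | _, .neg φ, v => ¬ φ.Sat v
  | _, .and φ ψ, v => φ.Sat v ∧ ψ.Sat v
  | _, .ball i φ, v => ∀ z : M, (z : ZFSet.{u}) ∈ (v i : ZFSet.{u}) → φ.Sat (Fin.cons z v)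

/-- The monoid (under composition) of all `Δ₀`-embeddings `M → M`: the maps that preserve and
reflect all `Δ₀` formulas. -/
def deltaZeroEmbeddings (M : Set ZFSet.{u}) : Submonoid (Function.End M) where
  carrier := {j | ∀ (n : ℕ) (φ : DeltaZeroFormula n) (v : Fin n → M),
    φ.Sat (fun i => j (v i)) ↔ φ.Sat v}
  one_mem' := fun _ _ _ => Iff.rfl
  mul_mem' := fun {_ k} hj hk n φ v => (hj n φ (fun i => k (v i))).trans (hk n φ v)

theorem deltaZero_subset {M : Set ZFSet.{u}} (hM : ∀ x ∈ M, ∀ y ∈ x, y ∈ M)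
    (j : deltaZeroEmbeddings M) {x y : M} (h : (x : ZFSet.{u}) ⊆ y) :
    (j.1 x : ZFSet.{u}) ⊆ (j.1 y : ZFSet.{u}) := by
  have key := (j.2 2 (.ball 0 (.mem 0 2)) ![x, y]).2 (fun z hz => h hz)
  exact fun z hz => key ⟨z, hM _ (j.1 x).2 z hz⟩ hz

theorem deltaZero_mem {M : Set ZFSet.{u}} (j : deltaZeroEmbeddings M) {x y : M}
    (h : (x : ZFSet.{u}) ∈ (y : ZFSet.{u})) : (j.1 x : ZFSet.{u}) ∈ (j.1 y : ZFSet.{u}) :=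
  (j.2 2 (.mem 0 1) ![x, y]).2 h

/-! ### The action on `P_{λ⁺⁺}(H(λ⁺))` -/

/-- `P_μ(M)`: the subsets of `M` with fewer than `μ` elements. -/
def SmallSubsets (M : Set ZFSet.{u}) (μ : Cardinal.{u}) : Type (u + 1) :=
  {A : Set M // #A < Cardinal.lift.{u + 1} μ}

/-- `A ∩ x`, as an element of `H(κ)`, for `A ⊆ H(κ)` and `x ∈ H(κ)`. -/
def trace {κ : Cardinal.{u}} (A : Set (H κ)) (x : H κ) : H κ :=
  ⟨ZFSet.sep (fun z => ∃ a ∈ A, (a : ZFSet.{u}) = z) x, H_of_subset x.2 ZFSet.sep_subset⟩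

/-- `j⁺(A) = ⋃_{x ∈ H(κ)} j(A ∩ x)`. -/
def plus {κ : Cardinal.{u}} (j : deltaZeroEmbeddings (H κ)) (A : Set (H κ)) : Set (H κ) :=
  {y | ∃ x : H κ, (y : ZFSet.{u}) ∈ (j.1 (trace A x) : ZFSet.{u})}

theorem mem_trace {κ : Cardinal.{u}} {A : Set (H κ)} {x z : H κ} :
    (z : ZFSet.{u}) ∈ (trace A x : ZFSet.{u}) ↔ (z : ZFSet.{u}) ∈ (x : ZFSet.{u}) ∧ z ∈ A := by
  simp only [trace, ZFSet.mem_sep]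
  refine and_congr_right fun _ => ⟨?_, fun h => ⟨z, h, rfl⟩⟩
  rintro ⟨a, ha, h⟩
  rwa [← Subtype.ext h]

theorem trans_H {κ : Cardinal.{u}} : ∀ x ∈ H κ, ∀ y ∈ x, y ∈ H κ := fun _ hx _ hy => H_of_mem hx hy

/-- Any `b ∈ H(κ)` with `b ⊆ A` contributes to `j⁺(A)`. -/
theorem mem_plus {κ : Cardinal.{u}} {j : deltaZeroEmbeddings (H κ)} {A : Set (H κ)} {y : H κ} :
    y ∈ plus j A ↔ ∃ b : H κ, (∀ z : H κ, (z : ZFSet.{u}) ∈ (b : ZFSet.{u}) → z ∈ A) ∧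
      (y : ZFSet.{u}) ∈ (j.1 b : ZFSet.{u}) := by
  constructor
  · rintro ⟨x, hx⟩
    exact ⟨trace A x, fun z hz => (mem_trace.1 hz).2, hx⟩
  · rintro ⟨b, hb, hy⟩
    refine ⟨b, deltaZero_subset trans_H j (fun z hz => ?_) hy⟩
    exact (mem_trace (z := ⟨z, H_of_mem b.2 hz⟩)).2 ⟨hz, hb _ hz⟩

/-- The set with elements `s`, for `s ⊆ H(λ⁺)` with at most `λ` elements. -/
theorem exists_H_of_card_le {lam : Cardinal.{u}} (hl : ℵ₀ ≤ lam) (s : Set (H (succ lam)))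
    (hs : #s ≤ Cardinal.lift.{u + 1} lam) :
    ∃ b : H (succ lam), ∀ z : H (succ lam), (z : ZFSet.{u}) ∈ (b : ZFSet.{u}) ↔ z ∈ s := by
  obtain ⟨c, hc⟩ := Cardinal.mem_range_lift_of_le hs
  have hsm : Small.{u} s := by
    induction c using Cardinal.inductionOn with
    | _ α =>
      rw [← Cardinal.mk_uLift] at hc
      obtain ⟨e⟩ := Cardinal.eq.1 hc
      exact ⟨α, ⟨(Equiv.ulift.symm.trans e).symm⟩⟩
  let g : s → ZFSet.{u} := fun z => (z.1 : ZFSet.{u})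
  have hg : ∀ z : H (succ lam), (z : ZFSet.{u}) ∈ ZFSet.range g ↔ z ∈ s := by
    intro z
    rw [ZFSet.mem_range]
    constructor
    · rintro ⟨i, hi⟩
      rw [← Subtype.ext (a1 := i.1) (a2 := z) hi]
      exact i.2
    · exact fun h => ⟨⟨z, h⟩, rfl⟩
  refine ⟨⟨ZFSet.range g, mem_H_of_card_le hl ?_ ?_⟩, hg⟩
  · intro x hx
    obtain ⟨i, rfl⟩ := ZFSet.mem_range.1 hx
    exact i.1.2
  · have h := ZFSet.lift_card_range_le (f := g)
    have h' : Cardinal.lift.{u + 1} (ZFSet.range g).card ≤ Cardinal.lift.{u + 1} lam := by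
      refine h.trans ?_
      rw [Cardinal.lift_id'.{u, u + 1}]
      exact hs
    exact Cardinal.lift_le.1 h'

theorem card_mem_le {lam : Cardinal.{u}} (b : H (succ lam)) :
    #{z : H (succ lam) | (z : ZFSet.{u}) ∈ (b : ZFSet.{u})} ≤ Cardinal.lift.{u + 1} lam := by
  refine le_trans ?_ (Cardinal.lift_le.2 (le_of_lt_succ (card_lt_of_mem_H b.2)))
  rw [← ZFSet.cardinalMk_coe_sort]
  exact Cardinal.mk_le_of_injective
    (f := fun z : {z : H (succ lam) | (z : ZFSet.{u}) ∈ (b : ZFSet.{u})} =>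
      (⟨z.1.1, z.2⟩ : (b : ZFSet.{u})))
    (fun z w h => Subtype.ext (Subtype.ext (by simpa using h)))

/-- `j⁺` maps `P_{λ⁺⁺}(H(λ⁺))` to itself. -/
theorem card_plus_lt {lam : Cardinal.{u}} (hl : ℵ₀ ≤ lam)
    (j : deltaZeroEmbeddings (H (succ lam))) (A : Set (H (succ lam)))
    (hA : #A < Cardinal.lift.{u + 1} (succ (succ lam))) :
    #(plus j A) < Cardinal.lift.{u + 1} (succ (succ lam)) := by
  set L : Cardinal.{u + 1} := Cardinal.lift.{u + 1} lam with hL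
  have hLi : ℵ₀ ≤ L := Cardinal.aleph0_le_lift.2 hl
  rw [Cardinal.lift_succ, Cardinal.lift_succ, ← hL, lt_succ_iff] at hA ⊢
  have hreg : (succ L).IsRegular := Cardinal.isRegular_succ hLi
  obtain ⟨e⟩ : Nonempty (A ↪ (succ L).ord.ToType) := by
    rw [← Cardinal.mk_ord_toType (succ L)] at hA
    exact hA
  have hseg : ∀ i : (succ L).ord.ToType, #{a : A | e a < i} ≤ L := by
    intro i
    rw [← lt_succ_iff]
    refine lt_of_le_of_lt ?_ (Cardinal.mk_Iio_toType_ord_lt i)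
    exact Cardinal.mk_le_of_injective
      (f := fun a : {a : A | e a < i} => (⟨e a.1, a.2⟩ : Set.Iio i))
      (fun a b h => Subtype.ext (e.injective (congrArg Subtype.val h)))
  have hex : ∀ i : (succ L).ord.ToType, ∃ b : H (succ lam), ∀ z : H (succ lam),
      (z : ZFSet.{u}) ∈ (b : ZFSet.{u}) ↔ z ∈ Subtype.val '' {a : A | e a < i} := fun i =>
    exists_H_of_card_le hl _ (Cardinal.mk_image_le.trans (hseg i))
  choose b hb using hex
  have hsub : plus j A ⊆ ⋃ i, {y : H (succ lam) | (y : ZFSet.{u}) ∈ (j.1 (b i) : ZFSet.{u})} := by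
    intro y hy
    obtain ⟨c, hc, hyc⟩ := mem_plus.1 hy
    let T := {z : H (succ lam) | (z : ZFSet.{u}) ∈ (c : ZFSet.{u})}
    have hbd : ∃ i, ∀ t : T, e ⟨t.1, hc t.1 t.2⟩ < i := by
      have hlt : #(Set.range fun t : T => e ⟨t.1, hc t.1 t.2⟩) < Order.cof (succ L).ord.ToType := by
        rw [Ordinal.cof_toType, hreg.cof_ord]
        exact lt_succ_of_le (Cardinal.mk_range_le.trans (card_mem_le c))
      have hn : ¬ IsCofinal (Set.range fun t : T => e ⟨t.1, hc t.1 t.2⟩) := fun h =>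
        absurd (Order.cof_le h) (not_le.2 hlt)
      rw [IsCofinal] at hn
      push Not at hn
      obtain ⟨i, hi⟩ := hn
      exact ⟨i, fun t => hi _ ⟨t, rfl⟩⟩
    obtain ⟨i, hi⟩ := hbd
    refine Set.mem_iUnion.2 ⟨i, deltaZero_subset trans_H j (fun z hz => ?_) hyc⟩
    exact (hb i ⟨z, H_of_mem c.2 hz⟩).2 ⟨⟨_, hc ⟨z, H_of_mem c.2 hz⟩ hz⟩, hi ⟨_, hz⟩, rfl⟩
  refine (Cardinal.mk_le_mk_of_subset hsub).trans ((Cardinal.mk_iUnion_le _).trans ?_)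
  rw [Cardinal.mk_ord_toType]
  refine (mul_le_mul' le_rfl (ciSup_le' fun i => (card_mem_le _).trans (le_succ L))).trans ?_
  exact (Cardinal.mul_eq_self (hLi.trans (le_succ L))).le

theorem plus_one {lam : Cardinal.{u}} (hl : ℵ₀ ≤ lam) (A : Set (H (succ lam))) :
    plus 1 A = A := by
  ext y
  rw [mem_plus]
  constructor
  · rintro ⟨b, hb, hy⟩
    exact hb y hy
  · intro hy
    obtain ⟨b, hb⟩ := exists_H_of_card_le hl {y} (by
      rw [Cardinal.mk_singleton]
      exact Cardinal.one_le_aleph0.trans (Cardinal.aleph0_le_lift.2 hl))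
    exact ⟨b, fun z hz => by rwa [(hb z).1 hz], (hb y).2 rfl⟩

theorem plus_mul {lam : Cardinal.{u}} (hl : ℵ₀ ≤ lam) (j k : deltaZeroEmbeddings (H (succ lam)))
    (A : Set (H (succ lam))) : plus (j * k) A = plus j (plus k A) := by
  ext y
  rw [mem_plus, mem_plus]
  constructor
  · rintro ⟨b, hb, hy⟩
    exact ⟨k.1 b, fun z hz => mem_plus.2 ⟨b, hb, hz⟩, hy⟩
  · rintro ⟨c, hc, hy⟩
    let T := {z : H (succ lam) | (z : ZFSet.{u}) ∈ (c : ZFSet.{u})}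
    have h1 : ∀ t : T, ∃ b : H (succ lam),
        (∀ z : H (succ lam), (z : ZFSet.{u}) ∈ (b : ZFSet.{u}) → z ∈ A) ∧
        (t.1 : ZFSet.{u}) ∈ (k.1 b : ZFSet.{u}) := fun t => mem_plus.1 (hc t.1 t.2)
    choose b hb hbt using h1
    obtain ⟨d, hd⟩ := exists_H_of_card_le hl
      (⋃ t : T, {z : H (succ lam) | (z : ZFSet.{u}) ∈ (b t : ZFSet.{u})}) (by
        refine (Cardinal.mk_iUnion_le _).trans ?_
        refine (mul_le_mul' (card_mem_le c) (ciSup_le' fun t => card_mem_le (b t))).trans ?_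
        exact (Cardinal.mul_eq_self (Cardinal.aleph0_le_lift.2 hl)).le)
    refine ⟨d, fun z hz => ?_, ?_⟩
    · obtain ⟨t, ht⟩ := Set.mem_iUnion.1 ((hd z).1 hz)
      exact hb t z ht
    · refine deltaZero_subset trans_H j (x := c) (y := k.1 d) (fun z hz => ?_) hy
      let t : T := ⟨⟨z, H_of_mem c.2 hz⟩, hz⟩
      refine deltaZero_subset trans_H k (x := b t) (y := d) (fun w hw => ?_) (hbt t)
      exact (hd ⟨w, H_of_mem (b t).2 hw⟩).2 (Set.mem_iUnion.2 ⟨t, hw⟩)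

/-- The action `j • A = j⁺(A)` of the monoid of `Δ₀`-embeddings of `H(λ⁺)` on
`P_{λ⁺⁺}(H(λ⁺))`, for an infinite cardinal `λ`. -/
instance plusAction (lam : Cardinal.{u}) [hl : Fact (ℵ₀ ≤ lam)] :
    MulAction (deltaZeroEmbeddings (H (succ lam))) (SmallSubsets (H (succ lam)) (succ (succ lam)))
    where
  smul j A := ⟨plus j A.1, card_plus_lt hl.out j A.1 A.2⟩
  one_smul A := Subtype.ext (plus_one hl.out A.1)
  mul_smul j k A := Subtype.ext (plus_mul hl.out j k A.1)

end DeltaZeroAction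

open DeltaZeroAction

universe v

/-! If `τ` is discrete, the product is discrete and continuity is trivial. For the converse it
suffices to find one set `A` of size at most `λ⁺` with `j ↦ j⁺(A)` injective: then `{j}` is the
preimage of the open point `j⁺(A)` under a continuous orbit map.

An embedding is determined by its values on the subsets of `i × i`, `i < λ`
(`eq_of_eqOn_boundedRel`). Each set in `H(λ⁺)` is the collapse of a relation on `λ`, and collapsing
is `Δ₀`; moreover `j(λ) = ⋃_{i<λ} j(i)` (`exists_mem_map_lowH`), so a relation on `λ` is controlled
by its bounded pieces. Since `2^{<λ} ≤ λ⁺`, there are at most `λ⁺` bounded relations.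

Let `F` map `λ⁺` to the bounded relations, taking every value on every `ω`-club
(`exists_forall_omegaClub_surjOn`), and let `A` be its graph. The common fixed points of `j` and `k`
form an `ω`-club, so every bounded relation `x` is `F(o)` for some `o` fixed by both. As `A` is the
graph of a function, the only point of `j⁺(A)` over `o` is `(o, j(x))`, and likewise for `k`; so
`j⁺(A) = k⁺(A)` forces `j(x) = k(x)`. -/

namespace DeltaZeroAction

/-! ### Definable notions and their preservation -/

namespace DeltaZeroFormula

variable {M : Set ZFSet.{u}} {n : ℕ}

/-- Disjunction. -/
def or (φ ψ : DeltaZeroFormula n) : DeltaZeroFormula n := neg (and (neg φ) (neg ψ))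

/-- Implication. -/
def imp (φ ψ : DeltaZeroFormula n) : DeltaZeroFormula n := neg (and φ (neg ψ))

/-- Bounded existential quantification. -/
def bex (i : Fin n) (φ : DeltaZeroFormula (n + 1)) : DeltaZeroFormula n := neg (ball i (neg φ))

/-- `v c = {v a, v b}`. -/
def upair (c a b : Fin n) : DeltaZeroFormula n :=
  and (and (mem a c) (mem b c)) (ball c (or (eq 0 a.succ) (eq 0 b.succ)))

/-- `v c = (v a, v b)`, as a Kuratowski pair. -/
def opair (c a b : Fin n) : DeltaZeroFormula n :=
  and (and (bex c (upair 0 a.succ a.succ)) (bex c (upair 0 a.succ b.succ)))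
    (ball c (or (upair 0 a.succ a.succ) (upair 0 a.succ b.succ)))

/-- `(v a, v b) ∈ v r`. -/
def rel (r a b : Fin n) : DeltaZeroFormula n := bex r (opair 0 a.succ b.succ)

/-- `v x` is transitive. -/
def trans (x : Fin n) : DeltaZeroFormula n := ball x (ball 0 (mem 0 x.succ.succ))

/-- `v y = v x ∪ {v x}`. -/
def succOf (y x : Fin n) : DeltaZeroFormula n :=
  and (mem x y) (and (ball y (or (eq 0 x.succ) (mem 0 x.succ))) (ball x (mem 0 y.succ)))

@[simp]
theorem sat_eq {i k : Fin n} {v : Fin n → M} : (eq i k).Sat v ↔ v i = v k := Iff.rfl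

@[simp]
theorem sat_mem {i k : Fin n} {v : Fin n → M} :
    (mem i k).Sat v ↔ (v i : ZFSet.{u}) ∈ (v k : ZFSet.{u}) := Iff.rfl

@[simp]
theorem sat_neg {φ : DeltaZeroFormula n} {v : Fin n → M} : (neg φ).Sat v ↔ ¬ φ.Sat v := Iff.rfl

@[simp]
theorem sat_and {φ ψ : DeltaZeroFormula n} {v : Fin n → M} :
    (and φ ψ).Sat v ↔ φ.Sat v ∧ ψ.Sat v := Iff.rfl

@[simp]
theorem sat_or {φ ψ : DeltaZeroFormula n} {v : Fin n → M} :
    (or φ ψ).Sat v ↔ φ.Sat v ∨ ψ.Sat v := by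
  rw [or, sat_neg, sat_and, sat_neg, sat_neg]
  tauto

@[simp]
theorem sat_imp {φ ψ : DeltaZeroFormula n} {v : Fin n → M} :
    (imp φ ψ).Sat v ↔ (φ.Sat v → ψ.Sat v) := by
  rw [imp, sat_neg, sat_and, sat_neg]
  tauto

variable (hM : ∀ x ∈ M, ∀ y ∈ x, y ∈ M)
include hM

/-- As `M` is transitive, a bounded quantifier sees every element of its bound, so `Δ₀` formulas are
absolute between `M` and the universe. -/
theorem sat_ball {i : Fin n} {φ : DeltaZeroFormula (n + 1)} {v : Fin n → M} :
    (ball i φ).Sat v ↔ ∀ z, ∀ h : z ∈ (v i : ZFSet.{u}),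
      φ.Sat (Fin.cons (α := fun _ => M) ⟨z, hM _ (v i).2 z h⟩ v) :=
  ⟨fun h z hz => h ⟨z, hM _ (v i).2 z hz⟩ hz, fun h z hz => h z hz⟩

theorem sat_bex {i : Fin n} {φ : DeltaZeroFormula (n + 1)} {v : Fin n → M} :
    (bex i φ).Sat v ↔ ∃ z, ∃ h : z ∈ (v i : ZFSet.{u}),
      φ.Sat (Fin.cons (α := fun _ => M) ⟨z, hM _ (v i).2 z h⟩ v) := by
  rw [bex, sat_neg, sat_ball hM]
  simp

theorem sat_upair {c a b : Fin n} {v : Fin n → M} :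
    (upair c a b).Sat v ↔ (v c : ZFSet.{u}) = {(v a : ZFSet.{u}), (v b : ZFSet.{u})} := by
  simp only [upair, sat_and, sat_mem, sat_ball hM, sat_or, sat_eq, Fin.cons_zero, Fin.cons_succ,
    Subtype.ext_iff]
  constructor
  · rintro ⟨⟨h1, h2⟩, h3⟩
    ext z
    rw [ZFSet.mem_pair]
    refine ⟨h3 z, ?_⟩
    rintro (rfl | rfl) <;> assumption
  · intro h
    rw [h]
    simp

theorem sat_opair {c a b : Fin n} {v : Fin n → M} :
    (opair c a b).Sat v ↔ (v c : ZFSet.{u}) = ZFSet.pair (v a) (v b) := by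
  simp only [opair, sat_and, sat_ball hM, sat_bex hM, sat_or, sat_upair hM, Fin.cons_zero,
    Fin.cons_succ, ZFSet.pair_eq_singleton, exists_prop, exists_eq_right, ZFSet.pair]
  constructor
  · rintro ⟨⟨h1, h2⟩, h3⟩
    ext z
    rw [ZFSet.mem_pair]
    refine ⟨h3 z, ?_⟩
    rintro (rfl | rfl) <;> assumption
  · intro h
    rw [h]
    simp

theorem sat_rel {r a b : Fin n} {v : Fin n → M} :
    (rel r a b).Sat v ↔ ZFSet.pair (v a) (v b) ∈ (v r : ZFSet.{u}) := by
  simp [rel, sat_bex hM, sat_opair hM]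

theorem sat_trans {x : Fin n} {v : Fin n → M} :
    (trans x).Sat v ↔ (v x : ZFSet.{u}).IsTransitive := by
  simp only [trans, sat_ball hM, sat_mem, Fin.cons_zero, Fin.cons_succ]
  rfl

theorem sat_succOf {y x : Fin n} {v : Fin n → M} :
    (succOf y x).Sat v ↔ (v y : ZFSet.{u}) = insert (v x : ZFSet.{u}) (v x : ZFSet.{u}) := by
  simp only [succOf, sat_and, sat_mem, sat_ball hM, sat_or, sat_eq, Fin.cons_zero, Fin.cons_succ,
    Subtype.ext_iff]
  constructor
  · rintro ⟨h1, h2, h3⟩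
    ext z
    rw [ZFSet.mem_insert_iff]
    refine ⟨h2 z, ?_⟩
    rintro (rfl | h)
    exacts [h1, h3 z h]
  · intro h
    rw [h]
    simp +contextual

end DeltaZeroFormula

/-! ### Set-theoretic notions preserved by `Δ₀`-embeddings. -/

section Preservation

open DeltaZeroFormula

variable {M : Set ZFSet.{u}} (hM : ∀ x ∈ M, ∀ y ∈ x, y ∈ M) (j : deltaZeroEmbeddings M)

theorem deltaZero_mem_iff {x y : M} :
    (j.1 x : ZFSet.{u}) ∈ (j.1 y : ZFSet.{u}) ↔ (x : ZFSet.{u}) ∈ (y : ZFSet.{u}) :=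
  j.2 2 (.mem 0 1) ![x, y]

include hM

theorem deltaZero_transitive {x : M} (h : (x : ZFSet.{u}).IsTransitive) :
    (j.1 x : ZFSet.{u}).IsTransitive := by
  have := (j.2 1 (trans 0) ![x]).2
  simp only [sat_trans hM] at this
  exact this h

theorem deltaZero_ordinal {x : M} (h : (x : ZFSet.{u}).IsOrdinal) :
    (j.1 x : ZFSet.{u}).IsOrdinal := by
  rw [ZFSet.isOrdinal_iff_forall_mem_isTransitive] at h ⊢
  refine ⟨deltaZero_transitive hM j h.1, ?_⟩
  have := (j.2 1 (ball 0 (trans 0)) ![x]).2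
  simp only [sat_ball hM, sat_trans hM, Fin.cons_zero] at this
  exact this h.2

theorem deltaZero_empty {x : M} (h : (x : ZFSet.{u}) = ∅) : (j.1 x : ZFSet.{u}) = ∅ := by
  rw [ZFSet.eq_empty] at h ⊢
  have := (j.2 1 (ball 0 (neg (eq 0 0))) ![x]).2
  simp only [sat_ball hM, sat_neg, sat_eq, not_true_eq_false] at this
  exact this h

theorem deltaZero_succ {x y : M} (h : (y : ZFSet.{u}) = insert (x : ZFSet.{u}) (x : ZFSet.{u})) :
    (j.1 y : ZFSet.{u}) = insert (j.1 x : ZFSet.{u}) (j.1 x : ZFSet.{u}) := by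
  have := (j.2 2 (succOf 1 0) ![x, y]).2
  simp only [sat_succOf hM] at this
  exact this h

theorem deltaZero_pair {a b c : M} (h : (c : ZFSet.{u}) = ZFSet.pair a b) :
    (j.1 c : ZFSet.{u}) = ZFSet.pair (j.1 a) (j.1 b) := by
  have := (j.2 3 (opair 2 0 1) ![a, b, c]).2
  simp only [sat_opair hM] at this
  exact this h

theorem deltaZero_singleton {a c : M} (h : (c : ZFSet.{u}) = {(a : ZFSet.{u})}) :
    (j.1 c : ZFSet.{u}) = {(j.1 a : ZFSet.{u})} := by
  have := (j.2 2 (upair 1 0 0) ![a, c]).2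
  simp only [sat_upair hM, ZFSet.pair_eq_singleton] at this
  exact this h

theorem deltaZero_inter {a b c : M} (h : (c : ZFSet.{u}) = (a : ZFSet.{u}) ∩ (b : ZFSet.{u})) :
    (j.1 c : ZFSet.{u}) = (j.1 a : ZFSet.{u}) ∩ (j.1 b : ZFSet.{u}) := by
  have key := (j.2 3 (and (ball 2 (and (mem 0 1) (mem 0 2))) (ball 0 (imp (mem 0 2) (mem 0 3))))
    ![a, b, c]).2
  simp only [sat_ball hM, sat_and, sat_imp, sat_mem] at key
  obtain ⟨h1, h2⟩ := key (by
    change (∀ z, z ∈ (c : ZFSet.{u}) → z ∈ (a : ZFSet.{u}) ∧ z ∈ (b : ZFSet.{u})) ∧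
      ∀ z, z ∈ (a : ZFSet.{u}) → z ∈ (b : ZFSet.{u}) → z ∈ (c : ZFSet.{u})
    rw [h]
    simp +contextual)
  ext z
  rw [ZFSet.mem_inter]
  exact ⟨h1 z, fun hz => h2 z hz.1 hz.2⟩

theorem deltaZero_prod {a b c : M} (h : (c : ZFSet.{u}) = ZFSet.prod a b) :
    (j.1 c : ZFSet.{u}) = ZFSet.prod (j.1 a) (j.1 b) := by
  have key := (j.2 3 (and (ball 2 (bex 1 (bex 3 (opair 2 1 0))))
    (ball 0 (ball 2 (rel 4 1 0)))) ![a, b, c]).2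
  simp only [sat_ball hM, sat_bex hM, sat_and, sat_opair hM, sat_rel hM] at key
  obtain ⟨h1, h2⟩ := key (by
    change (∀ z, z ∈ (c : ZFSet.{u}) → ∃ x, ∃ _ : x ∈ (a : ZFSet.{u}), ∃ y,
      ∃ _ : y ∈ (b : ZFSet.{u}), z = ZFSet.pair x y) ∧
      ∀ z, z ∈ (a : ZFSet.{u}) → ∀ w, w ∈ (b : ZFSet.{u}) → ZFSet.pair z w ∈ (c : ZFSet.{u})
    rw [h]
    simp +contextual [ZFSet.mem_prod])
  ext z
  rw [ZFSet.mem_prod]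
  constructor
  · intro hz
    obtain ⟨x, hx, y, hy, e⟩ := h1 z hz
    exact ⟨x, hx, y, hy, e⟩
  · rintro ⟨x, hx, y, hy, rfl⟩
    exact h2 x hx y hy

theorem deltaZero_total {a b r : M}
    (h : ∀ x ∈ (a : ZFSet.{u}), ∃ y ∈ (b : ZFSet.{u}), ZFSet.pair x y ∈ (r : ZFSet.{u})) :
    ∀ x ∈ (j.1 a : ZFSet.{u}), ∃ y ∈ (j.1 b : ZFSet.{u}),
      ZFSet.pair x y ∈ (j.1 r : ZFSet.{u}) := by
  have key := (j.2 3 (ball 0 (bex 2 (rel 4 1 0))) ![a, b, r]).2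
  simp only [sat_ball hM, sat_bex hM, sat_rel hM] at key
  intro x hx
  obtain ⟨y, hy, e⟩ := key (fun x hx => let ⟨y, hy, e⟩ := h x hx; ⟨y, hy, e⟩) x hx
  exact ⟨y, hy, e⟩

omit hM in
/-- `G ⊆ L × t` relates each point of `L` to sets in `t` collapsing the relation `E`. -/
def Collapses (L t E G : ZFSet.{u}) : Prop :=
  ∀ x ∈ L, ∀ p ∈ t, ZFSet.pair x p ∈ G →
    (∀ q ∈ p, ∃ y ∈ L, ZFSet.pair y x ∈ E ∧ ZFSet.pair y q ∈ G) ∧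
    ∀ y ∈ L, ZFSet.pair y x ∈ E → ∀ q ∈ t, ZFSet.pair y q ∈ G → q ∈ p

/-- With the graph `G` and its target `t` as parameters, the recursion clause of a Mostowski
collapse has only bounded quantifiers. -/
theorem deltaZero_collapses {L t E G : M} (h : Collapses L t E G) :
    Collapses (j.1 L) (j.1 t) (j.1 E) (j.1 G) := by
  have key := (j.2 4 (ball 0 (ball 2 (imp (rel 5 1 0) (and
    (ball 0 (bex 3 (and (rel 6 0 3) (rel 7 0 1))))
    (ball 2 (imp (rel 5 0 2) (ball 4 (imp (rel 7 1 0) (mem 0 2))))))))) ![L, t, E, G]).2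
  simp only [sat_ball hM, sat_bex hM, sat_rel hM, sat_and, sat_imp, sat_mem] at key
  intro x hx p hp hxp
  obtain ⟨h1, h2⟩ := key (fun x hx p hp hxp => ⟨fun q hq =>
    let ⟨y, hy, e⟩ := (h x hx p hp hxp).1 q hq; ⟨y, hy, e⟩, (h x hx p hp hxp).2⟩) x hx p hp hxp
  exact ⟨fun q hq => let ⟨y, hy, e⟩ := h1 q hq; ⟨y, hy, e⟩, h2⟩

/-- A set each of whose elements is empty or a successor of an element is mapped onto the
pointwise image. -/
theorem deltaZero_image_of_succ {x : M}
    (h : ∀ n ∈ (x : ZFSet.{u}), n = ∅ ∨ ∃ m ∈ (x : ZFSet.{u}), n = insert m m)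
    (h0 : ∅ ∈ (x : ZFSet.{u}))
    (hs : ∀ m ∈ (x : ZFSet.{u}), insert m m ∈ (x : ZFSet.{u})) :
    ∀ y ∈ (j.1 x : ZFSet.{u}), ∃ n : M, (n : ZFSet.{u}) ∈ (x : ZFSet.{u}) ∧
      y = (j.1 n : ZFSet.{u}) := by
  have key := (j.2 1 (ball 0 (or (ball 0 (neg (eq 0 0))) (bex 1 (succOf 1 0)))) ![x]).2
  simp only [sat_ball hM, sat_bex hM, sat_or, sat_succOf hM, sat_neg, sat_eq, not_true_eq_false]
    at key
  have key' := key (fun n hn => (h n hn).imp (fun e => (ZFSet.eq_empty n).1 e)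
    fun ⟨m, hm, e⟩ => ⟨m, hm, e⟩)
  intro y
  -- Membership in `j(x)` is genuine, so descending through predecessors ends at `∅`: no nonstandard
  -- elements arise.
  induction y using ZFSet.inductionOn with
  | _ y ih =>
    intro hy
    rcases key' y hy with e | ⟨m, hm, e⟩
    · refine ⟨⟨∅, hM _ x.2 _ h0⟩, h0, ?_⟩
      rw [deltaZero_empty hM j rfl]
      exact (ZFSet.eq_empty y).2 e
    · change y = insert m m at e
      obtain ⟨n, hn, rfl⟩ := ih m (e ▸ ZFSet.mem_insert m m) hm
      refine ⟨⟨_, hM _ x.2 _ (hs n hn)⟩, hs n hn, ?_⟩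
      rw [e, deltaZero_succ hM j (x := n) (y := ⟨_, hM _ x.2 _ (hs n hn)⟩) rfl]

end Preservation

end DeltaZeroAction

namespace DeltaZeroAction

/-! ### Combinatorics: diagonalization and `ω`-clubs -/

/-- Diagonalization: let `r i` represent the fibre of `w` with index `i`, and let `f ξ` avoid `r i
ξ` for all `i < ξ`, which excludes fewer than `#J` values. Then `f` differs from the representative
of its own fibre past the index of that fibre. The default `id` at unused indices is harmless. -/
theorem exists_eventually_ne {J X : Type*} [LinearOrder J] (hJ : ∀ i : J, #(Set.Iio i) < #J)
    (e : X ↪ J) (w : (J → J) → X) :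
    ∃ f g : J → J, ∃ γ : J, w f = w g ∧ ∀ i, γ < i → f i ≠ g i := by
  classical
  let r : J → J → J := fun i => if h : ∃ g, e (w g) = i then h.choose else id
  have hr : ∀ f, w f = w (r (e (w f))) := by
    intro f
    have h : ∃ g, e (w g) = e (w f) := ⟨f, rfl⟩
    have : r (e (w f)) = h.choose := dif_pos h
    rw [this]
    exact (e.injective h.choose_spec).symm
  have hex : ∀ ξ : J, ∃ y, ∀ i < ξ, r i ξ ≠ y := by
    intro ξ
    by_contra! hc
    choose i hi hiy using hc
    refine (hJ ξ).not_ge ?_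
    exact Cardinal.mk_le_of_injective (f := fun y => (⟨i y, hi y⟩ : Set.Iio ξ)) fun a b h => by
      have h' : i a = i b := congrArg Subtype.val h
      rw [← hiy a, ← hiy b, h']
  choose f hf using hex
  exact ⟨f, r (e (w f)), e (w f), hr f, fun i hi h => hf i _ hi h.symm⟩

/-- Unbounded sets closed under suprema of monotone sequences. -/
structure IsOmegaClub {I : Type*} [LinearOrder I] (C : Set I) : Prop where
  unbounded : ∀ a, ∃ b ∈ C, a ≤ b
  closed : ∀ s : ℕ → I, Monotone s → (∀ n, s n ∈ C) → ∀ a, IsLUB (Set.range s) a → a ∈ C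

/-! ### `ω`-clubs on a well-order of successor cardinal type. -/

section

variable {I : Type v} [LinearOrder I] {μ : Cardinal.{v}}

/-- Regularity of `μ⁺`: otherwise `I` would be covered by `μ` many segments of size at most `μ`. -/
theorem exists_forall_lt_of_card_le (hμ : ℵ₀ ≤ μ) (hI : #I = succ μ)
    (hseg : ∀ a : I, #(Set.Iio a) ≤ μ) (S : Set I) (hS : #S ≤ μ) : ∃ a, ∀ s ∈ S, s < a := by
  by_contra! hc
  have hcov : (Set.univ : Set I) ⊆ ⋃ s : S, insert s.1 (Set.Iio s.1) := by
    intro a _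
    obtain ⟨s, hs, has⟩ := hc a
    refine Set.mem_iUnion.2 ⟨⟨s, hs⟩, ?_⟩
    rcases has.eq_or_lt with h | h
    exacts [Or.inl h, Or.inr h]
  have hle : #I ≤ μ := by
    rw [← Cardinal.mk_univ]
    refine (Cardinal.mk_le_mk_of_subset hcov).trans ((Cardinal.mk_iUnion_le _).trans ?_)
    refine (mul_le_mul' hS (ciSup_le' fun s => ?_)).trans (Cardinal.mul_eq_self hμ).le
    refine Cardinal.mk_insert_le.trans ?_
    exact (add_le_add (hseg _) (Cardinal.one_le_aleph0.trans hμ)).trans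
      (Cardinal.add_eq_self hμ).le
  exact (lt_succ μ).not_ge (hI ▸ hle)

theorem exists_isLUB_seq [WellFoundedLT I] (hμ : ℵ₀ ≤ μ) (hI : #I = succ μ)
    (hseg : ∀ a : I, #(Set.Iio a) ≤ μ) (s : ℕ → I) : ∃ a, IsLUB (Set.range s) a := by
  obtain ⟨b, hb⟩ := exists_forall_lt_of_card_le hμ hI hseg (Set.range s)
    ((Set.countable_range s).le_aleph0.trans hμ)
  obtain ⟨m, hm, hmin⟩ := (wellFounded_lt (α := I)).has_min (upperBounds (Set.range s))
    ⟨b, fun x hx => (hb x hx).le⟩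
  exact ⟨m, hm, fun x hx => not_lt.1 (hmin x hx)⟩

/-- One step of `g` passes beyond a next point of every `C i` at once. Iterating it `ω` times
interleaves all the sequences `f i (s n)` with `s`, so they share one supremum. -/
theorem IsOmegaClub.iInter [WellFoundedLT I] (hμ : ℵ₀ ≤ μ) (hI : #I = succ μ)
    (hseg : ∀ a : I, #(Set.Iio a) ≤ μ) {ι : Type v} (hι : #ι ≤ μ) {C : ι → Set I}
    (hC : ∀ i, IsOmegaClub (C i)) : IsOmegaClub (⋂ i, C i) := by
  refine ⟨fun a => ?_, fun s hs hsC b hb => Set.mem_iInter.2 fun i =>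
    (hC i).closed s hs (fun n => Set.mem_iInter.1 (hsC n) i) b hb⟩
  choose f hfC hf using fun i => (hC i).unbounded
  have hg : ∀ x, ∃ y, x < y ∧ ∀ i, f i x < y := by
    intro x
    obtain ⟨y, hy⟩ := exists_forall_lt_of_card_le hμ hI hseg
      (insert x (Set.range fun i => f i x)) (Cardinal.mk_insert_le.trans
        ((add_le_add (Cardinal.mk_range_le.trans hι) (Cardinal.one_le_aleph0.trans hμ)).trans
          (Cardinal.add_eq_self hμ).le))
    exact ⟨y, hy x (Or.inl rfl), fun i => hy _ (Or.inr ⟨i, rfl⟩)⟩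
  choose g hg1 hg2 using hg
  let s : ℕ → I := fun n => g^[n] a
  have hs : ∀ n, s (n + 1) = g (s n) := fun n => Function.iterate_succ_apply' g n a
  obtain ⟨m, hm⟩ := exists_isLUB_seq hμ hI hseg s
  have hlt : ∀ i n, f i (s n) < s (n + 1) := fun i n => by
    rw [hs]
    exact hg2 _ i
  refine ⟨m, Set.mem_iInter.2 fun i => (hC i).closed (fun n => f i (s n))
    (monotone_nat_of_le_succ fun n => (hlt i n).le.trans (hf i _)) (fun n => hfC i _) m
    ⟨?_, fun b hb => hm.2 ?_⟩, hm.1 ⟨0, rfl⟩⟩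
  · rintro _ ⟨n, rfl⟩
    exact (hlt i n).le.trans (hm.1 ⟨n + 1, rfl⟩)
  · rintro _ ⟨n, rfl⟩
    exact (hf i _).trans (hb ⟨n, rfl⟩)

/-- Ulam's argument: a successor cardinal carries a function into any set of at most that size
taking all values on every `ω`-club. -/
theorem exists_forall_omegaClub_surjOn [WellFoundedLT I] (hμ : ℵ₀ ≤ μ) (hI : #I = succ μ)
    (hseg : ∀ a : I, #(Set.Iio a) ≤ μ) {P : Type v} [Nonempty P] (hP : #P ≤ succ μ) :
    ∃ F : I → P, ∀ C, IsOmegaClub C → ∀ p, ∃ a ∈ C, F a = p := by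
  classical
  obtain ⟨K, rfl⟩ : ∃ K : Type v, #K = μ := ⟨μ.out, μ.mk_out⟩
  have e : ∀ a : I, Set.Iio a ↪ K := fun a => Classical.choice (hseg a)
  -- If each colour `ξ` were avoided on some `ω`-club, the intersection of these `μ` clubs would
  -- contain some `a > b`, and `e a b` would be a colour avoided at `a`.
  have hpos : ∀ b : I, ∃ ξ : K, ∀ C, IsOmegaClub C → ∃ a ∈ C, ∃ h : b < a, e a ⟨b, h⟩ = ξ := by
    intro b
    by_contra! hc
    choose C hC hne using hc
    obtain ⟨b', hb'⟩ := exists_forall_lt_of_card_le hμ hI hseg {b}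
      ((Cardinal.mk_singleton b).le.trans (Cardinal.one_le_aleph0.trans hμ))
    obtain ⟨a, ha, hba⟩ := (IsOmegaClub.iInter hμ hI hseg le_rfl hC).unbounded b'
    have hlt : b < a := (hb' b rfl).trans_le hba
    exact hne (e a ⟨b, hlt⟩) a (Set.mem_iInter.1 ha _) hlt rfl
  choose ξ hξ using hpos
  -- Only `μ` colours occur, so `μ⁺` many `b` share one colour `k`; these `b` label the points of
  -- `P`.
  obtain ⟨k, hk⟩ := Cardinal.infinite_pigeonhole_card ξ (succ #K) hI.ge
    (hμ.trans (le_succ _)) (by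
      rw [(Cardinal.isRegular_succ hμ).cof_ord]
      exact lt_succ _)
  obtain ⟨i⟩ : Nonempty (P ↪ ξ ⁻¹' {k}) := hP.trans hk
  -- Each `e a` is injective, so at most one label below `a` has colour `k`; `F a` is the point it
  -- labels.
  let F : I → P := fun a =>
    if h : ∃ p, ∃ h : (i p).1 < a, e a ⟨_, h⟩ = k then h.choose else Classical.arbitrary P
  refine ⟨F, fun C hC p => ?_⟩
  obtain ⟨a, ha, hlt, hea⟩ := hξ (i p).1 C hC
  have hik : ξ (i p).1 = k := (i p).2
  have h : ∃ p, ∃ h : (i p).1 < a, e a ⟨_, h⟩ = k := ⟨p, hlt, hea.trans hik⟩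
  refine ⟨a, ha, ?_⟩
  have hF : F a = h.choose := dif_pos h
  obtain ⟨hlt', hea'⟩ := h.choose_spec
  rw [hF]
  have hval := Subtype.mk.inj ((e a).injective (hea'.trans (hea.trans hik).symm))
  exact i.injective (Subtype.ext hval)

end

end DeltaZeroAction

namespace DeltaZeroAction

/-! ### Closure properties of `H(λ⁺)` -/

section Closure

variable {lam : Cardinal.{u}} (hl : ℵ₀ ≤ lam)
include hl

theorem insert_mem_H {a b : ZFSet.{u}} (ha : a ∈ H (succ lam)) (hb : b ∈ H (succ lam)) :
    insert a b ∈ H (succ lam) := by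
  refine mem_H_of_card_le hl (fun x hx => ?_) (ZFSet.card_insert_le.trans ?_)
  · rcases ZFSet.mem_insert_iff.1 hx with rfl | hx
    exacts [ha, H_of_mem hb hx]
  · exact (add_le_add (le_of_lt_succ (card_lt_of_mem_H hb)) (Cardinal.one_le_aleph0.trans hl)).trans
      (Cardinal.add_eq_self hl).le

theorem singleton_mem_H {a : ZFSet.{u}} (ha : a ∈ H (succ lam)) : {a} ∈ H (succ lam) := by
  refine mem_H_of_card_le hl (fun x hx => ?_) ?_
  · rwa [ZFSet.mem_singleton.1 hx]
  · rw [ZFSet.card_singleton]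
    exact Cardinal.one_le_aleph0.trans hl

theorem pair_mem_H {a b : ZFSet.{u}} (ha : a ∈ H (succ lam)) (hb : b ∈ H (succ lam)) :
    ZFSet.pair a b ∈ H (succ lam) :=
  insert_mem_H hl (singleton_mem_H hl ha) <| singleton_mem_H hl <|
    insert_mem_H hl ha (singleton_mem_H hl hb)

theorem prod_mem_H {a b : ZFSet.{u}} (ha : a ∈ H (succ lam)) (hb : b ∈ H (succ lam)) :
    ZFSet.prod a b ∈ H (succ lam) := by
  refine mem_H_of_card_le hl (fun z hz => ?_) ?_
  · obtain ⟨x, hx, y, hy, rfl⟩ := ZFSet.mem_prod.1 hz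
    exact pair_mem_H hl (H_of_mem ha hx) (H_of_mem hb hy)
  · let f : Shrink.{u} a × Shrink.{u} b → ZFSet.{u} := fun p =>
      ZFSet.pair ((equivShrink a).symm p.1).1 ((equivShrink b).symm p.2).1
    have hsub : ZFSet.prod a b ⊆ ZFSet.range f := by
      intro z hz
      obtain ⟨x, hx, y, hy, rfl⟩ := ZFSet.mem_prod.1 hz
      exact ZFSet.mem_range.2 ⟨(equivShrink a ⟨x, hx⟩, equivShrink b ⟨y, hy⟩), by simp [f]⟩
    have h1 := ZFSet.lift_card_range_le (f := f)
    rw [Cardinal.lift_id, Cardinal.lift_id, Cardinal.mk_prod, Cardinal.lift_id,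
      Cardinal.lift_id] at h1
    refine (ZFSet.card_mono hsub).trans (h1.trans ?_)
    exact (mul_le_mul' (le_of_lt_succ (card_lt_of_mem_H ha))
      (le_of_lt_succ (card_lt_of_mem_H hb))).trans (Cardinal.mul_eq_self hl).le

end Closure

theorem trcl_mem_H {κ : Cardinal.{u}} {x : ZFSet.{u}} (hx : x ∈ H κ) : trcl x ∈ H κ :=
  mem_H_of_subset (isTransitive_trcl x) (fun _ h => h) hx

theorem toZFSet_mem_H {κ : Cardinal.{u}} {o : Ordinal.{u}} (ho : o < κ.ord) : o.toZFSet ∈ H κ :=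
  mem_H_of_subset (ZFSet.isOrdinal_toZFSet o).isTransitive (fun _ h => h) <| by
    rwa [Ordinal.card_toZFSet, ← Cardinal.lt_ord]

theorem rank_lt_of_mem_H {κ : Cardinal.{u}} {x : ZFSet.{u}} (hx : x ∈ H κ) (ho : x.IsOrdinal) :
    x.rank < κ.ord := by
  rw [Cardinal.lt_ord, ← Ordinal.card_toZFSet, ho.toZFSet_rank_eq]
  exact card_lt_of_mem_H hx

/-- The von Neumann ordinal of `o`, as an element of `H(κ)`. -/
noncomputable def ordH {κ : Cardinal.{u}} (o : Set.Iio κ.ord) : H κ :=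
  ⟨o.1.toZFSet, toZFSet_mem_H o.2⟩

/-- `a × b` in `H(λ⁺)`. -/
def prodH {lam : Cardinal.{u}} (hl : ℵ₀ ≤ lam) (a b : H (succ lam)) : H (succ lam) :=
  ⟨ZFSet.prod a b, prod_mem_H hl a.2 b.2⟩

theorem coe_prodH {lam : Cardinal.{u}} (hl : ℵ₀ ≤ lam) (a b : H (succ lam)) :
    (prodH hl a b : ZFSet.{u}) = ZFSet.prod a b := rfl

/-- `a ∩ b` in `H(κ)`. -/
def interH {κ : Cardinal.{u}} (a b : H κ) : H κ :=
  ⟨(a : ZFSet.{u}) ∩ b, H_of_subset a.2 fun _ h => (ZFSet.mem_inter.1 h).1⟩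

/-- The relation `R` between elements of `a` and elements of `b`, as a set in `H(λ⁺)`. -/
noncomputable def graphH {lam : Cardinal.{u}} (hl : ℵ₀ ≤ lam) (a b : H (succ lam))
    (R : ZFSet.{u} → ZFSet.{u} → Prop) : H (succ lam) :=
  ⟨ZFSet.sep (fun z => ∃ x y, z = ZFSet.pair x y ∧ R x y) (prodH hl a b),
    H_of_subset (prodH hl a b).2 ZFSet.sep_subset⟩

/-! ### Graphs inside `H(λ⁺)` and their images under embeddings. -/

section Embedding

variable {lam : Cardinal.{u}} {hl : ℵ₀ ≤ lam}

theorem pair_mem_graphH {a b : H (succ lam)} {R : ZFSet.{u} → ZFSet.{u} → Prop}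
    {x y : ZFSet.{u}} : ZFSet.pair x y ∈ (graphH hl a b R : ZFSet.{u}) ↔
      x ∈ (a : ZFSet.{u}) ∧ y ∈ (b : ZFSet.{u}) ∧ R x y := by
  simp only [graphH, prodH, ZFSet.mem_sep, ZFSet.pair_mem_prod, ZFSet.pair_inj]
  constructor
  · rintro ⟨⟨hx, hy⟩, _, _, ⟨rfl, rfl⟩, h⟩
    exact ⟨hx, hy, h⟩
  · rintro ⟨hx, hy, h⟩
    exact ⟨⟨hx, hy⟩, x, y, ⟨rfl, rfl⟩, h⟩

theorem graphH_subset {a b : H (succ lam)} {R : ZFSet.{u} → ZFSet.{u} → Prop} :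
    (graphH hl a b R : ZFSet.{u}) ⊆ ZFSet.prod a b := by
  simp only [graphH, prodH]
  exact ZFSet.sep_subset

variable (j : deltaZeroEmbeddings (H (succ lam)))

theorem map_prodH (a b : H (succ lam)) :
    (j.1 (prodH hl a b) : ZFSet.{u}) = ZFSet.prod (j.1 a) (j.1 b) :=
  deltaZero_prod trans_H j rfl

theorem map_interH {κ : Cardinal.{u}} (j : deltaZeroEmbeddings (H κ)) (a b : H κ) :
    (j.1 (interH a b) : ZFSet.{u}) = (j.1 a : ZFSet.{u}) ∩ (j.1 b : ZFSet.{u}) :=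
  deltaZero_inter trans_H j rfl

/-! ### Fixed points -/

theorem mem_ordH {κ : Cardinal.{u}} {o : Set.Iio κ.ord} {x : ZFSet.{u}} :
    x ∈ (ordH o : ZFSet.{u}) ↔ ∃ a : Set.Iio κ.ord, a < o ∧ (ordH a : ZFSet.{u}) = x := by
  rw [ordH, Ordinal.mem_toZFSet_iff]
  constructor
  · rintro ⟨a, ha, rfl⟩
    exact ⟨⟨a, ha.trans o.2⟩, ha, rfl⟩
  · rintro ⟨a, ha, rfl⟩
    exact ⟨a.1, ha, rfl⟩

theorem exists_map_ordH_eq {κ : Cardinal.{u}} (j : deltaZeroEmbeddings (H κ))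
    (o : Set.Iio κ.ord) : ∃ a : Set.Iio κ.ord, j.1 (ordH o) = ordH a := by
  have h := deltaZero_ordinal trans_H j (x := ordH o) (ZFSet.isOrdinal_toZFSet o.1)
  exact ⟨⟨_, rank_lt_of_mem_H (j.1 (ordH o)).2 h⟩, Subtype.ext h.toZFSet_rank_eq.symm⟩

theorem ordH_subset_map {κ : Cardinal.{u}} (j : deltaZeroEmbeddings (H κ)) (o : Set.Iio κ.ord) :
    (ordH o : ZFSet.{u}) ⊆ (j.1 (ordH o) : ZFSet.{u}) := by
  induction o using WellFoundedLT.induction with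
  | _ o ih =>
    intro x hx
    obtain ⟨a, ha, rfl⟩ := mem_ordH.1 hx
    exact ZFSet.IsOrdinal.mem_of_subset_of_mem (ZFSet.isOrdinal_toZFSet a.1)
      (deltaZero_ordinal trans_H j (x := ordH o) (ZFSet.isOrdinal_toZFSet o.1)) (ih a ha)
      ((deltaZero_mem_iff j).2 hx)

/-- Continuity at countable unions. The relation "`y ∈ s n`" between `x` and `ω` is total, so its
image is total on `j(x)`; every element of `j(ω)` is some `j(n)`, and the section of the image at
`j(n)` lies in `j(s n)`. -/
theorem mem_map_union_seq (hl : ℵ₀ ≤ lam) {s : ℕ → H (succ lam)} {x : H (succ lam)}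
    (hx : ∀ y ∈ (x : ZFSet.{u}), ∃ n, y ∈ (s n : ZFSet.{u})) :
    ∀ y ∈ (j.1 x : ZFSet.{u}), ∃ n, y ∈ (j.1 (s n) : ZFSet.{u}) := by
  have hω : Ordinal.omega0.{u} < (succ lam).ord := by
    rw [Cardinal.lt_ord, Ordinal.card_omega0]
    exact lt_succ_of_le hl
  let w : H (succ lam) := ordH ⟨Ordinal.omega0, hω⟩
  have hw : ∀ z : ZFSet.{u}, z ∈ (w : ZFSet.{u}) ↔ ∃ n : ℕ, z = (n : Ordinal.{u}).toZFSet := by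
    intro z
    change z ∈ Ordinal.omega0.toZFSet ↔ _
    rw [Ordinal.mem_toZFSet_iff]
    constructor
    · rintro ⟨a, ha, rfl⟩
      obtain ⟨n, rfl⟩ := Ordinal.lt_omega0.1 ha
      exact ⟨n, rfl⟩
    · rintro ⟨n, rfl⟩
      exact ⟨n, Ordinal.natCast_lt_omega0 n, rfl⟩
  have himg := deltaZero_image_of_succ trans_H j (x := w) (by
      intro z hz
      obtain ⟨n, rfl⟩ := (hw z).1 hz
      cases n with
      | zero => left; simp
      | succ n => exact Or.inr ⟨_, (hw _).2 ⟨n, rfl⟩, by simp⟩)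
    ((hw _).2 ⟨0, by simp⟩) (by
      intro m hm
      obtain ⟨n, rfl⟩ := (hw m).1 hm
      exact (hw _).2 ⟨n + 1, by simp⟩)
  let R : H (succ lam) := graphH hl x w fun y z =>
    ∀ n : ℕ, z = (n : Ordinal.{u}).toZFSet → y ∈ (s n : ZFSet.{u})
  have htot := deltaZero_total trans_H j (a := x) (b := w) (r := R) (by
    intro y hy
    obtain ⟨n, hn⟩ := hx y hy
    refine ⟨_, (hw _).2 ⟨n, rfl⟩, pair_mem_graphH.2 ⟨hy, (hw _).2 ⟨n, rfl⟩, fun m hm => ?_⟩⟩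
    have : n = m := by exact_mod_cast Ordinal.toZFSet_injective hm
    rwa [← this])
  intro y hy
  obtain ⟨z, hz, hyz⟩ := htot y hy
  obtain ⟨n, hn, rfl⟩ := himg z hz
  obtain ⟨k, hk⟩ := (hw n).1 hn
  refine ⟨k, ?_⟩
  let c : H (succ lam) := ⟨{(n : ZFSet.{u})}, singleton_mem_H hl n.2⟩
  have hsub := deltaZero_subset trans_H j (x := interH R (prodH hl x c))
    (y := prodH hl (s k) c) (by
      intro p hp
      obtain ⟨hpR, hp⟩ := ZFSet.mem_inter.1 hp
      obtain ⟨a, -, b, hb, rfl⟩ := ZFSet.mem_prod.1 hp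
      refine ZFSet.pair_mem_prod.2 ⟨(pair_mem_graphH.1 hpR).2.2 k ?_, hb⟩
      rw [ZFSet.mem_singleton.1 hb, hk])
  rw [map_interH, map_prodH, map_prodH, deltaZero_singleton trans_H j (a := n) (c := c) rfl] at hsub
  refine (ZFSet.pair_mem_prod.1 (hsub (ZFSet.mem_inter.2 ⟨hyz, ZFSet.pair_mem_prod.2 ⟨hy, ?_⟩⟩))).1
  exact ZFSet.mem_singleton.2 rfl

theorem mk_Iio_ord_succ : #(Set.Iio (succ lam).ord) = succ (Cardinal.lift.{u + 1} lam) := by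
  rw [Cardinal.mk_Iio_ordinal, Cardinal.card_ord, Cardinal.lift_succ]

theorem mk_Iio_Iio_ord_succ (a : Set.Iio (succ lam).ord) :
    #(Set.Iio a) ≤ Cardinal.lift.{u + 1} lam := by
  have h : #(Set.Iio a.1) ≤ Cardinal.lift.{u + 1} lam := by
    rw [Cardinal.mk_Iio_ordinal, Cardinal.lift_le, ← lt_succ_iff, ← Cardinal.lt_ord]
    exact a.2
  refine le_trans ?_ h
  exact Cardinal.mk_le_of_injective (f := fun b : Set.Iio a => (⟨b.1.1, b.2⟩ : Set.Iio a.1))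
    fun b c h => Subtype.ext (Subtype.ext (Subtype.mk.inj h))

theorem isOmegaClub_fixedPoints (hl : ℵ₀ ≤ lam) :
    IsOmegaClub {o : Set.Iio (succ lam).ord | j.1 (ordH o) = ordH o} := by
  have hLUB := exists_isLUB_seq (Cardinal.aleph0_le_lift.2 hl) mk_Iio_ord_succ
    (mk_Iio_Iio_ord_succ (lam := lam))
  have hsup : ∀ (s : ℕ → Set.Iio (succ lam).ord) a, IsLUB (Set.range s) a →
      ∀ y ∈ (ordH a : ZFSet.{u}), ∃ n, y ∈ (ordH (s n) : ZFSet.{u}) := by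
    intro s a ha y hy
    obtain ⟨b, hb, rfl⟩ := mem_ordH.1 hy
    obtain ⟨_, ⟨n, rfl⟩, hn⟩ := (lt_isLUB_iff ha).1 hb
    exact ⟨n, mem_ordH.2 ⟨b, hn, rfl⟩⟩
  have hmono : ∀ a b : Set.Iio (succ lam).ord, a ≤ b →
      (ordH a : ZFSet.{u}) ⊆ (ordH b : ZFSet.{u}) := fun a b h => Ordinal.toZFSet_monotone h
  -- Closure takes `t = s`. Unboundedness takes the iterates of `o ↦ j(o)` for `s` and their shift
  -- for `t`.
  have hfix : ∀ (s t : ℕ → Set.Iio (succ lam).ord) a, IsLUB (Set.range s) a →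
      (∀ n, j.1 (ordH (s n)) = ordH (t n)) → (∀ n, t n ≤ a) → j.1 (ordH a) = ordH a := by
    intro s t a ha ht hle
    refine Subtype.ext (subset_antisymm ?_ (ordH_subset_map j a))
    intro y hy
    obtain ⟨n, hn⟩ := mem_map_union_seq j hl (s := fun n => ordH (s n)) (hsup s a ha) y hy
    rw [ht n] at hn
    exact hmono _ _ (hle n) hn
  choose g hg using exists_map_ordH_eq j
  have hle : ∀ o, o ≤ g o := by
    intro o
    have := ordH_subset_map j o
    rw [hg o] at this
    exact Ordinal.toZFSet_subset_toZFSet_iff.1 this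
  refine ⟨fun a => ?_, fun s hs hsC a ha => hfix s s a ha hsC fun n => ha.1 ⟨n, rfl⟩⟩
  obtain ⟨m, hm⟩ := hLUB fun n => g^[n] a
  refine ⟨m, hfix (fun n => g^[n] a) (fun n => g^[n + 1] a) m hm (fun n => ?_)
    (fun n => hm.1 ⟨n + 1, rfl⟩), hm.1 ⟨0, rfl⟩⟩
  rw [hg, Function.iterate_succ_apply']

end Embedding

end DeltaZeroAction

namespace DeltaZeroAction

/-! ### Embeddings are determined by their values on bounded relations on `λ` -/

section Determination

variable {lam : Cardinal.{u}}

theorem ord_lt_ord_succ (lam : Cardinal.{u}) : lam.ord < (succ lam).ord :=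
  Cardinal.ord_lt_ord.2 (lt_succ lam)

/-- `i`, as an element of `H(λ⁺)`, for `i < λ`. -/
noncomputable def lowH (i : Set.Iio lam.ord) : H (succ lam) :=
  ordH ⟨i.1, i.2.trans (ord_lt_ord_succ lam)⟩

/-- `λ`, as an element of `H(λ⁺)`. -/
noncomputable def topH (lam : Cardinal.{u}) : H (succ lam) :=
  ordH ⟨lam.ord, ord_lt_ord_succ lam⟩

theorem mem_topH {x : ZFSet.{u}} :
    x ∈ (topH lam : ZFSet.{u}) ↔ ∃ i : Set.Iio lam.ord, (lowH i : ZFSet.{u}) = x := by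
  change x ∈ lam.ord.toZFSet ↔ _
  rw [Ordinal.mem_toZFSet_iff]
  constructor
  · rintro ⟨a, ha, rfl⟩
    exact ⟨⟨a, ha⟩, rfl⟩
  · rintro ⟨a, rfl⟩
    exact ⟨a.1, a.2, rfl⟩

theorem lowH_mem_topH (i : Set.Iio lam.ord) : (lowH i : ZFSet.{u}) ∈ (topH lam : ZFSet.{u}) :=
  mem_topH.2 ⟨i, rfl⟩

theorem lowH_mem_lowH {i k : Set.Iio lam.ord} :
    (lowH i : ZFSet.{u}) ∈ (lowH k : ZFSet.{u}) ↔ i < k :=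
  Ordinal.toZFSet_mem_toZFSet_iff

theorem lowH_subset_lowH {i k : Set.Iio lam.ord} (h : i ≤ k) :
    (lowH i : ZFSet.{u}) ⊆ (lowH k : ZFSet.{u}) :=
  Ordinal.toZFSet_monotone h

theorem lowH_injective {i k : Set.Iio lam.ord} (h : (lowH i : ZFSet.{u}) = lowH k) : i = k :=
  Subtype.ext (Ordinal.toZFSet_injective h)

theorem mk_Iio_ord : #(Set.Iio lam.ord) = Cardinal.lift.{u + 1} lam := by
  rw [Cardinal.mk_Iio_ordinal, Cardinal.card_ord]

theorem mk_Iio_lt (i : Set.Iio lam.ord) : #(Set.Iio i) < #(Set.Iio lam.ord) := by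
  have h : #(Set.Iio i.1) < Cardinal.lift.{u + 1} lam := by
    rw [Cardinal.mk_Iio_ordinal, Cardinal.lift_lt, ← Cardinal.lt_ord]
    exact i.2
  rw [mk_Iio_ord]
  refine lt_of_le_of_lt ?_ h
  exact Cardinal.mk_le_of_injective (f := fun b : Set.Iio i => (⟨b.1.1, b.2⟩ : Set.Iio i.1))
    fun b c h => Subtype.ext (Subtype.ext (Subtype.mk.inj h))

theorem mk_coe_le (b : H (succ lam)) : #(b : ZFSet.{u}) ≤ #(Set.Iio lam.ord) := by
  rw [mk_Iio_ord, ZFSet.cardinalMk_coe_sort, Cardinal.lift_le]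
  exact le_of_lt_succ (card_lt_of_mem_H b.2)

/-- Every `Δ₀`-embedding of `H(λ⁺)` is continuous at `λ`. -/
theorem exists_mem_map_lowH (hl : ℵ₀ ≤ lam) (j : deltaZeroEmbeddings (H (succ lam))) :
    ∀ x ∈ (j.1 (topH lam) : ZFSet.{u}), ∃ i : Set.Iio lam.ord,
      x ∈ (j.1 (lowH i) : ZFSet.{u}) := by
  intro d hd
  by_contra! hc
  -- If `d` is in no `j(i)`, it acts as a point at infinity: the image of the graph of each `f : λ →
  -- λ` gives `f` a value at `d` in `j(λ)`, which has at most `λ` elements.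
  let G : (Set.Iio lam.ord → Set.Iio lam.ord) → H (succ lam) := fun f =>
    graphH hl (topH lam) (topH lam) fun x y =>
      ∃ i, x = (lowH i : ZFSet.{u}) ∧ y = (lowH (f i) : ZFSet.{u})
  have hval : ∀ f, ∃ y ∈ (j.1 (topH lam) : ZFSet.{u}), ZFSet.pair d y ∈ (j.1 (G f) : ZFSet.{u}) := by
    intro f
    refine deltaZero_total trans_H j (fun x hx => ?_) d hd
    obtain ⟨i, rfl⟩ := mem_topH.1 hx
    exact ⟨_, lowH_mem_topH (f i), pair_mem_graphH.2
      ⟨lowH_mem_topH i, lowH_mem_topH (f i), i, rfl, rfl⟩⟩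
  choose w hw hdw using hval
  obtain ⟨e⟩ : Nonempty ((j.1 (topH lam) : ZFSet.{u}) ↪ Set.Iio lam.ord) := mk_coe_le _
  obtain ⟨f, g, γ, hfg, hne⟩ := exists_eventually_ne mk_Iio_lt e
    (fun f => (⟨w f, hw f⟩ : (j.1 (topH lam) : ZFSet.{u})))
  have hfg' : w f = w g := congrArg Subtype.val hfg
  have hlim : IsSuccLimit lam.ord := Cardinal.isSuccLimit_ord hl
  -- `f` and `g` may still agree at `γ`, so they agree only below `γ + 1`. Having a common value at
  -- `d`, their images put `d` into `j(γ + 1)`.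
  let γ' : Set.Iio lam.ord := ⟨succ γ.1, hlim.succ_lt γ.2⟩
  have hsub := deltaZero_subset trans_H j (x := interH (G f) (G g))
    (y := prodH hl (lowH γ') (topH lam)) (by
      intro p hp
      obtain ⟨hpf, hpg⟩ := ZFSet.mem_inter.1 hp
      obtain ⟨a, -, b, hb, rfl⟩ := ZFSet.mem_prod.1 (graphH_subset hpf)
      rw [coe_prodH]
      refine ZFSet.pair_mem_prod.2 ⟨?_, hb⟩
      obtain ⟨-, -, i, rfl, hi⟩ := pair_mem_graphH.1 hpf
      obtain ⟨-, -, k, hik, hk⟩ := pair_mem_graphH.1 hpg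
      obtain rfl := lowH_injective hik
      refine lowH_mem_lowH.2 (lt_of_not_ge fun hle => hne i ?_ (lowH_injective (hi.symm.trans hk)))
      exact (Order.succ_le_iff (a := γ.1) (b := i.1)).1 hle)
  rw [map_interH, map_prodH] at hsub
  exact hc γ' (ZFSet.pair_mem_prod.1 (hsub (ZFSet.mem_inter.2 ⟨hdw f, hfg' ▸ hdw g⟩))).1

/-- Uniqueness of the Mostowski collapse, by `∈`-induction. Two targets are allowed because `j(t)`
and `k(t)` are not yet known to agree. -/
theorem eq_of_collapses {L t t' E G G' : ZFSet.{u}} (ht : t.IsTransitive) (ht' : t'.IsTransitive)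
    (hG : Collapses L t E G) (hG' : Collapses L t' E G')
    (htot : ∀ x ∈ L, ∃ p ∈ t, ZFSet.pair x p ∈ G)
    (htot' : ∀ x ∈ L, ∃ p ∈ t', ZFSet.pair x p ∈ G') (p : ZFSet.{u}) :
    p ∈ t → ∀ x ∈ L, ∀ p' ∈ t', ZFSet.pair x p ∈ G → ZFSet.pair x p' ∈ G' → p = p' := by
  induction p using ZFSet.inductionOn with
  | _ p ih =>
    intro hp x hx p' hp' hxp hxp'
    obtain ⟨h1, h2⟩ := hG x hx p hp hxp
    obtain ⟨h1', h2'⟩ := hG' x hx p' hp' hxp'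
    ext q
    constructor
    · intro hq
      obtain ⟨y, hy, hyx, hyq⟩ := h1 q hq
      obtain ⟨q', hq', hyq'⟩ := htot' y hy
      rw [ih q hq (ht p hp hq) y hy q' hq' hyq hyq']
      exact h2' y hy hyx q' hq' hyq'
    · intro hq
      obtain ⟨y, hy, hyx, hyq⟩ := h1' q hq
      obtain ⟨q', hq', hyq'⟩ := htot y hy
      have hq'p := h2 y hy hyx q' hq' hyq'
      rwa [← ih q' hq'p hq' y hy q (ht' p' hp' hq) hyq' hyq]

/-- The subsets of `i × i` for some `i < λ`. -/
def boundedRel (hl : ℵ₀ ≤ lam) : Set (H (succ lam)) :=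
  {x | ∃ i : Set.Iio lam.ord, (x : ZFSet.{u}) ⊆ (prodH hl (lowH i) (lowH i) : ZFSet.{u})}

/-- There are `λ` choices of `i`, each with at most `2^|i × i| ≤ 2^{<λ}` relations. This is where
the hypothesis on `2^{<λ}` does its work. -/
theorem mk_boundedRel_le (hl : ℵ₀ ≤ lam) (hlam : (2 : Cardinal.{u}) ^< lam ≤ succ lam) :
    #(boundedRel hl) ≤ succ (Cardinal.lift.{u + 1} lam) := by
  have hcov : boundedRel hl = ⋃ i : Set.Iio lam.ord,
      {x : H (succ lam) | (x : ZFSet.{u}) ⊆ (prodH hl (lowH i) (lowH i) : ZFSet.{u})} := by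
    ext x
    simp [boundedRel]
  have hone : ∀ i : Set.Iio lam.ord,
      #{x : H (succ lam) | (x : ZFSet.{u}) ⊆ (prodH hl (lowH i) (lowH i) : ZFSet.{u})} ≤
        Cardinal.lift.{u + 1} (succ lam) := by
    intro i
    let f : {x : H (succ lam) | (x : ZFSet.{u}) ⊆ (prodH hl (lowH i) (lowH i) : ZFSet.{u})} →
        Set (Set.Iio i.1 × Set.Iio i.1) := fun x =>
      {q | ZFSet.pair q.1.1.toZFSet q.2.1.toZFSet ∈ (x.1 : ZFSet.{u})}
    have hsub : ∀ x y, f x ⊆ f y → (x.1 : ZFSet.{u}) ⊆ (y.1 : ZFSet.{u}) := by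
      intro x y h p hp
      obtain ⟨a, ha, b, hb, rfl⟩ := ZFSet.mem_prod.1 (coe_prodH hl _ _ ▸ x.2 hp)
      obtain ⟨a, hai, rfl⟩ := Ordinal.mem_toZFSet_iff.1 ha
      obtain ⟨b, hbi, rfl⟩ := Ordinal.mem_toZFSet_iff.1 hb
      exact h (show (⟨⟨a, hai⟩, ⟨b, hbi⟩⟩ : Set.Iio i.1 × Set.Iio i.1) ∈ f x from hp)
    have hinj : Function.Injective f := fun x y h =>
      Subtype.ext (Subtype.ext (subset_antisymm (hsub x y h.le) (hsub y x h.ge)))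
    have hi : i.1.card < lam := Cardinal.lt_ord.1 i.2
    refine (Cardinal.mk_le_of_injective hinj).trans ?_
    rw [Cardinal.mk_set, Cardinal.mk_prod, Cardinal.lift_id, Cardinal.mk_Iio_ordinal,
      ← Cardinal.lift_mul, ← Cardinal.lift_two_power, Cardinal.lift_le]
    exact (Cardinal.le_powerlt 2 (Cardinal.mul_lt_of_lt hl hi hi)).trans hlam
  rw [← Cardinal.lift_succ, hcov]
  refine (Cardinal.mk_iUnion_le _).trans ((mul_le_mul' ?_ (ciSup_le' hone)).trans
    (Cardinal.mul_eq_self (Cardinal.aleph0_le_lift.2 (hl.trans (le_succ lam)))).le)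
  rw [mk_Iio_ord, Cardinal.lift_le]
  exact le_succ lam

variable {j k : deltaZeroEmbeddings (H (succ lam))}

theorem map_lowH_eq (hl : ℵ₀ ≤ lam) (h : ∀ x ∈ boundedRel hl, j.1 x = k.1 x)
    (i : Set.Iio lam.ord) : j.1 (lowH i) = k.1 (lowH i) := by
  have hp := congrArg Subtype.val (h (prodH hl (lowH i) (lowH i)) ⟨i, fun _ h => h⟩)
  rw [map_prodH, map_prodH] at hp
  refine Subtype.ext (ZFSet.ext fun z => ?_)
  -- The diagonal of `j(i) × j(i)` recovers `j(i)`.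
  have hz : ZFSet.pair z z ∈ ZFSet.prod (j.1 (lowH i)) (j.1 (lowH i)) ↔
      ZFSet.pair z z ∈ ZFSet.prod (k.1 (lowH i)) (k.1 (lowH i)) := by rw [hp]
  simpa only [ZFSet.pair_mem_prod, and_self] using hz

theorem map_topH_subset (hl : ℵ₀ ≤ lam) (h : ∀ x ∈ boundedRel hl, j.1 x = k.1 x) :
    (j.1 (topH lam) : ZFSet.{u}) ⊆ (k.1 (topH lam) : ZFSet.{u}) := by
  intro x hx
  obtain ⟨i, hi⟩ := exists_mem_map_lowH hl j x hx
  rw [map_lowH_eq hl h] at hi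
  exact deltaZero_subset trans_H k (fun y hy =>
    (ZFSet.isOrdinal_toZFSet lam.ord).mem_trans hy (lowH_mem_topH i)) hi

/-- By continuity at `λ`, each pair in `j(E)` already lies in `j(E ∩ (m × m))` for some `m < λ`,
where `j` and `k` agree. -/
theorem map_rel_subset (hl : ℵ₀ ≤ lam) (h : ∀ x ∈ boundedRel hl, j.1 x = k.1 x)
    {E : H (succ lam)} (hE : (E : ZFSet.{u}) ⊆ (prodH hl (topH lam) (topH lam) : ZFSet.{u})) :
    (j.1 E : ZFSet.{u}) ⊆ (k.1 E : ZFSet.{u}) := by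
  intro p hp
  have hp' := deltaZero_subset trans_H j hE hp
  rw [map_prodH] at hp'
  obtain ⟨x, hx, y, hy, rfl⟩ := ZFSet.mem_prod.1 hp'
  obtain ⟨a, ha⟩ := exists_mem_map_lowH hl j x hx
  obtain ⟨b, hb⟩ := exists_mem_map_lowH hl j y hy
  have hmem : ZFSet.pair x y ∈
      (j.1 (interH (prodH hl (lowH (max a b)) (lowH (max a b))) E) : ZFSet.{u}) := by
    rw [map_interH, map_prodH]
    exact ZFSet.mem_inter.2 ⟨ZFSet.pair_mem_prod.2
      ⟨deltaZero_subset trans_H j (lowH_subset_lowH (le_max_left a b)) ha,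
        deltaZero_subset trans_H j (lowH_subset_lowH (le_max_right a b)) hb⟩, hp⟩
  rw [h _ ⟨max a b, fun z hz => (ZFSet.mem_inter.1 hz).1⟩, map_interH] at hmem
  exact (ZFSet.mem_inter.1 hmem).2

/-- A `Δ₀`-embedding of `H(λ⁺)` is determined by its values on bounded relations on `λ`. -/
theorem eq_of_eqOn_boundedRel (hl : ℵ₀ ≤ lam) (h : ∀ x ∈ boundedRel hl, j.1 x = k.1 x) :
    j = k := by
  have h' : ∀ x ∈ boundedRel hl, k.1 x = j.1 x := fun x hx => (h x hx).symm
  have htop : j.1 (topH lam) = k.1 (topH lam) :=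
    Subtype.ext (subset_antisymm (map_topH_subset hl h) (map_topH_subset hl h'))
  refine Subtype.ext (funext fun x => ?_)
  let t : H (succ lam) := ⟨insert x.1 (trcl x), insert_mem_H hl x.2 (trcl_mem_H x.2)⟩
  have htr : (t : ZFSet.{u}).IsTransitive := by
    intro y hy z hz
    rcases ZFSet.mem_insert_iff.1 hy with rfl | hy
    · exact ZFSet.mem_insert_of_mem _ (subset_trcl _ hz)
    · exact ZFSet.mem_insert_of_mem _ (isTransitive_trcl _ y hy hz)
  have hxt : (x : ZFSet.{u}) ∈ (t : ZFSet.{u}) := ZFSet.mem_insert _ _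
  obtain ⟨e⟩ : Nonempty ((t : ZFSet.{u}) ↪ Set.Iio lam.ord) := mk_coe_le t
  have : Nonempty (t : ZFSet.{u}) := ⟨⟨x, hxt⟩⟩
  -- `g` enumerates a transitive set containing `x`, with repetitions allowed; `E` is membership
  -- pulled back along `g`, and `G` is the graph of `g`.
  let g : Set.Iio lam.ord → (t : ZFSet.{u}) := Function.invFun e
  have hg : Function.Surjective g := Function.invFun_surjective e.injective
  let G : H (succ lam) := graphH hl (topH lam) t fun a p =>
    ∃ i, a = (lowH i : ZFSet.{u}) ∧ p = (g i).1
  let E : H (succ lam) := graphH hl (topH lam) (topH lam) fun a b =>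
    ∃ i i', a = (lowH i : ZFSet.{u}) ∧ b = (lowH i' : ZFSet.{u}) ∧ (g i).1 ∈ (g i').1
  have hGm : ∀ i, ZFSet.pair (lowH i) (g i).1 ∈ (G : ZFSet.{u}) := fun i =>
    pair_mem_graphH.2 ⟨lowH_mem_topH i, (g i).2, i, rfl, rfl⟩
  have hGe : ∀ i p, ZFSet.pair (lowH i) p ∈ (G : ZFSet.{u}) → p = (g i).1 := by
    intro i p hp
    obtain ⟨-, -, i', hi, rfl⟩ := pair_mem_graphH.1 hp
    rw [lowH_injective hi]
  have hEm : ∀ i i', ZFSet.pair (lowH i) (lowH i') ∈ (E : ZFSet.{u}) ↔ (g i).1 ∈ (g i').1 := by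
    intro i i'
    refine pair_mem_graphH.trans ⟨?_, fun h =>
      ⟨lowH_mem_topH i, lowH_mem_topH i', i, i', rfl, rfl, h⟩⟩
    rintro ⟨-, -, a, b, ha, hb, h⟩
    rwa [lowH_injective ha, lowH_injective hb]
  have hcol : Collapses (topH lam) t E G := by
    intro a ha p hp hap
    obtain ⟨i, rfl⟩ := mem_topH.1 ha
    obtain rfl := hGe i p hap
    constructor
    · intro q hq
      obtain ⟨i', hi'⟩ := hg ⟨q, htr _ (g i).2 hq⟩
      have hq' : (g i').1 = q := congrArg Subtype.val hi'
      refine ⟨lowH i', lowH_mem_topH i', (hEm i' i).2 (hq' ▸ hq), hq' ▸ hGm i'⟩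
    · intro b hb hba q hq hbq
      obtain ⟨i', rfl⟩ := mem_topH.1 hb
      obtain rfl := hGe i' q hbq
      exact (hEm i' i).1 hba
  have htot : ∀ a ∈ (topH lam : ZFSet.{u}), ∃ p ∈ (t : ZFSet.{u}),
      ZFSet.pair a p ∈ (G : ZFSet.{u}) := by
    intro a ha
    obtain ⟨i, rfl⟩ := mem_topH.1 ha
    exact ⟨_, (g i).2, hGm i⟩
  have hE : j.1 E = k.1 E := Subtype.ext
    (subset_antisymm (map_rel_subset hl h graphH_subset) (map_rel_subset hl h' graphH_subset))
  obtain ⟨i, hi⟩ := hg ⟨x, hxt⟩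
  let c : H (succ lam) := ⟨ZFSet.pair (lowH i) x, pair_mem_H hl (lowH i).2 x.2⟩
  have hc : (c : ZFSet.{u}) ∈ (G : ZFSet.{u}) := by
    have := hGm i
    rwa [hi] at this
  have hpair : ∀ l : deltaZeroEmbeddings (H (succ lam)),
      ZFSet.pair (l.1 (lowH i)) (l.1 x) ∈ (l.1 G : ZFSet.{u}) := by
    intro l
    rw [← deltaZero_pair trans_H l (c := c) rfl]
    exact deltaZero_mem l hc
  have hcolk := deltaZero_collapses trans_H k hcol
  have htotk := deltaZero_total trans_H k htot
  have hpk := hpair k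
  -- Now `j(G)` and `k(G)` collapse the same relation on the same set, so they agree at the point
  -- `j(i) = k(i)` coding `x`.
  rw [← htop] at htotk hcolk
  rw [← hE] at hcolk
  rw [← map_lowH_eq hl h i] at hpk
  exact Subtype.ext (eq_of_collapses (deltaZero_transitive trans_H j htr)
    (deltaZero_transitive trans_H k htr) (deltaZero_collapses trans_H j hcol) hcolk
    (deltaZero_total trans_H j htot) htotk _ (deltaZero_mem j hxt) _
    (deltaZero_mem j (lowH_mem_topH i)) _ (deltaZero_mem k hxt) (hpair j) hpk)

end Determination

/-! ### A subset of `H(λ⁺)` of size `λ⁺` which separates all embeddings -/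

theorem exists_separating_set {lam : Cardinal.{u}} (hl : ℵ₀ ≤ lam)
    (hlam : (2 : Cardinal.{u}) ^< lam ≤ succ lam) :
    ∃ A : Set (H (succ lam)), #A < Cardinal.lift.{u + 1} (succ (succ lam)) ∧
      ∀ j k : deltaZeroEmbeddings (H (succ lam)), plus j A = plus k A → j = k := by
  have hL : ℵ₀ ≤ Cardinal.lift.{u + 1} lam := Cardinal.aleph0_le_lift.2 hl
  have : Nonempty (boundedRel hl) := by
    refine ⟨⟨⟨∅, mem_H_of_card_le hl (fun x hx => absurd hx (ZFSet.notMem_empty x)) (by simp)⟩,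
      ⟨0, ?_⟩, fun x hx => absurd hx (ZFSet.notMem_empty x)⟩⟩
    exact Cardinal.ord_pos.2 (Cardinal.aleph0_pos.trans_le hl)
  obtain ⟨F, hF⟩ := exists_forall_omegaClub_surjOn hL mk_Iio_ord_succ
    (mk_Iio_Iio_ord_succ (lam := lam)) (mk_boundedRel_le hl hlam)
  let c : Set.Iio (succ lam).ord → H (succ lam) := fun o =>
    ⟨ZFSet.pair (ordH o) (F o).1, pair_mem_H hl (ordH o).2 (F o).1.2⟩
  refine ⟨Set.range c, ?_, fun j k hjk => eq_of_eqOn_boundedRel hl fun x hx => ?_⟩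
  · refine Cardinal.mk_range_le.trans_lt ?_
    rw [mk_Iio_ord_succ, ← Cardinal.lift_succ, Cardinal.lift_lt]
    exact lt_succ _
  -- The common fixed points of `j` and `k`, as an intersection of two `ω`-clubs.
  have hclub : IsOmegaClub (⋂ b : ULift.{u + 1} Bool, {o : Set.Iio (succ lam).ord |
      (bif b.down then j else k).1 (ordH o) = ordH o}) :=
    IsOmegaClub.iInter hL mk_Iio_ord_succ mk_Iio_Iio_ord_succ
      ((Cardinal.mk_le_aleph0).trans hL) fun b => isOmegaClub_fixedPoints _ hl
  obtain ⟨o, ho, hox⟩ := hF _ hclub ⟨x, hx⟩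
  have hoj : j.1 (ordH o) = ordH o := Set.mem_iInter.1 ho ⟨true⟩
  have hok : k.1 (ordH o) = ordH o := Set.mem_iInter.1 ho ⟨false⟩
  have hFx : (F o).1 = x := congrArg Subtype.val hox
  have hmem : j.1 (c o) ∈ plus j (Set.range c) := by
    obtain ⟨b, hb⟩ := exists_H_of_card_le hl {c o} (by
      rw [Cardinal.mk_singleton]
      exact Cardinal.one_le_aleph0.trans hL)
    exact mem_plus.2 ⟨b, fun z hz => ⟨o, ((hb z).1 hz).symm⟩, deltaZero_mem j ((hb _).2 rfl)⟩
  rw [hjk, mem_plus] at hmem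
  obtain ⟨b, hb, hjb⟩ := hmem
  rw [deltaZero_pair trans_H j (a := ordH o) (b := x) (c := c o) (by rw [← hFx]), hoj] at hjb
  -- `T` bounds both coordinates of `b`, so the part of `b` over `o` is `({o} × T) ∩ b`, an
  -- expression that `k` respects.
  let T : H (succ lam) := ⟨trcl b, trcl_mem_H b.2⟩
  have hbT : (b : ZFSet.{u}) ⊆ (prodH hl T T : ZFSet.{u}) := by
    intro p hp
    obtain ⟨o', ho'⟩ := hb ⟨p, H_of_mem b.2 hp⟩ hp
    have hp' : p = ZFSet.pair (ordH o') (F o').1 := (congrArg Subtype.val ho').symm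
    have h1 : ({(ordH o' : ZFSet.{u}), ((F o').1 : ZFSet.{u})} : ZFSet.{u}) ∈ trcl b :=
      isTransitive_trcl _ p (subset_trcl _ hp) (by rw [hp']; simp [ZFSet.pair])
    rw [hp']
    exact ZFSet.pair_mem_prod.2 ⟨isTransitive_trcl _ _ h1 (by simp),
      isTransitive_trcl _ _ h1 (by simp)⟩
  have hjT := deltaZero_subset trans_H k hbT hjb
  rw [map_prodH] at hjT
  let s : H (succ lam) := ⟨{(ordH o : ZFSet.{u})}, singleton_mem_H hl (ordH o).2⟩
  let s' : H (succ lam) := ⟨{(x : ZFSet.{u})}, singleton_mem_H hl x.2⟩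
  -- The only pair in `A` over `o` is `(o, x)`. Applying `k`, which fixes `o`, leaves `k(x)` as the
  -- only possible second coordinate over `o` in `k(b)`, and `(o, j(x))` lies there.
  have hsub := deltaZero_subset trans_H k (x := interH (prodH hl s T) b)
    (y := prodH hl s s') (by
      intro p hp
      obtain ⟨hps, hpb⟩ := ZFSet.mem_inter.1 hp
      obtain ⟨o', ho'⟩ := hb ⟨p, H_of_mem b.2 hpb⟩ hpb
      have hp' : p = ZFSet.pair (ordH o') (F o').1 := (congrArg Subtype.val ho').symm
      rw [coe_prodH, hp'] at hps
      rw [coe_prodH, hp']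
      obtain ⟨h1, -⟩ := ZFSet.pair_mem_prod.1 hps
      have hoo : o' = o :=
        Subtype.ext (Ordinal.toZFSet_injective (ZFSet.mem_singleton.1 h1))
      refine ZFSet.pair_mem_prod.2 ⟨h1, ZFSet.mem_singleton.2 ?_⟩
      rw [hoo, hFx])
  rw [map_interH, map_prodH, map_prodH, deltaZero_singleton trans_H k (a := ordH o) (c := s) rfl,
    deltaZero_singleton trans_H k (a := x) (c := s') rfl, hok] at hsub
  have := hsub (ZFSet.mem_inter.2 ⟨ZFSet.pair_mem_prod.2 ⟨ZFSet.mem_singleton.2 rfl,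
    (ZFSet.pair_mem_prod.1 hjT).2⟩, hjb⟩)
  exact Subtype.ext (ZFSet.mem_singleton.1 (ZFSet.pair_mem_prod.1 this).2)

end DeltaZeroAction

open DeltaZeroAction
theorem mainTheorem5 (lam : Cardinal.{u}) [Fact (ℵ₀ ≤ lam)]
    (hlam : (2 : Cardinal.{u}) ^< lam ≤ succ lam)
    (τ : TopologicalSpace (deltaZeroEmbeddings (H (succ lam)))) :
    @ContinuousSMul (deltaZeroEmbeddings (H (succ lam)))
        (SmallSubsets (H (succ lam)) (succ (succ lam))) _ τ ⊥ ↔ τ = ⊥ := by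
  let : TopologicalSpace (SmallSubsets (H (succ lam)) (succ (succ lam))) := ⊥
  have : DiscreteTopology (SmallSubsets (H (succ lam)) (succ (succ lam))) := ⟨rfl⟩
  constructor
  · intro hcont
    obtain ⟨A, hA, hsep⟩ := exists_separating_set (Fact.out : ℵ₀ ≤ lam) hlam
    let a : SmallSubsets (H (succ lam)) (succ (succ lam)) := ⟨A, hA⟩
    have hc : Continuous fun j : deltaZeroEmbeddings (H (succ lam)) => j • a :=
      continuous_id.smul continuous_const
    refine eq_bot_of_singletons_open fun j => ?_
    have hpre : (fun k : deltaZeroEmbeddings (H (succ lam)) => k • a) ⁻¹' {j • a} = {j} := by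
      ext k
      refine ⟨fun h => hsep k j (congrArg Subtype.val h), ?_⟩
      rintro rfl
      rfl
    rw [← hpre]
    exact (isOpen_discrete _).preimage hc
  · rintro rfl
    let : TopologicalSpace (deltaZeroEmbeddings (H (succ lam))) := ⊥
    have : DiscreteTopology (deltaZeroEmbeddings (H (succ lam))) := ⟨rfl⟩
    exact ⟨continuous_of_discreteTopology⟩
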